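/- Let $k\ge 1$ be an integer and let $G$ be a finite simple undirected graph of order $n$ with $n\ge 12k-8$ and minimum degree $\delta(G)\ge \frac n3+k$. Suppose that $|N_G(x)\cup N_G(y)|\ge \frac{2n}{3}$ for any two distinct nonadjacent vertices $x,y\in V(G)$, where $N_G(x)$ is the set of vertices adjacent to $x$. Then $G$ is fractional ID-$k$-factor-critical; that is, for every independent set $I$ of $G$ the graph $G-I$ has a fractional $k$-factor: there is a function $h:E(G-I)\to[0,1]$ such that $\sum_{e\ni x}h(e)=k$ for every vertex $x$ of $G-I$, the sum being over the edges $e$ of $G-I$ incident with $x$. -/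

import Mathlib

namespace SimpleGraph

open Classical in
/-- `h` is the indicator function of a fractional `[a, b]`-factor of the finite graph `G`:
it takes values in `[0, 1]` on the edges of `G`, and at each vertex `x` the sum of `h` over the
edges of `G` incident with `x` lies between `a` and `b`. (The values of `h` off the edge set of `G`
play no role.) -/
def IsFractionalFactorIndicator {V : Type*} [Fintype V] (G : SimpleGraph V) (a b : ℕ)
    (h : Sym2 V → ℝ) : Prop :=
  (∀ e ∈ G.edgeSet, 0 ≤ h e ∧ h e ≤ 1) ∧
    ∀ x : V, (a : ℝ) ≤ ∑ e ∈ G.incidenceFinset x, h e ∧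
      ∑ e ∈ G.incidenceFinset x, h e ≤ (b : ℝ)

/-- `G` has a fractional `[a, b]`-factor, i.e. some `h` is the indicator function of one; the factor
itself is the subgraph of `G` formed by the edges `e` with `h e > 0`. -/
def HasFractionalFactor {V : Type*} [Fintype V] (G : SimpleGraph V) (a b : ℕ) : Prop :=
  ∃ h : Sym2 V → ℝ, G.IsFractionalFactorIndicator a b h

open Classical in
/-- `G` is fractional independent-set-deletable `[a, b]`-factor-critical: `G - I` has a fractional
`[a, b]`-factor for every independent set `I` of `G`. -/
def IsFractionalIDFactorCritical {V : Type*} [Fintype V] (G : SimpleGraph V) (a b : ℕ) : Prop :=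
  ∀ I : Set V, G.IsIndepSet I → (G.induce Iᶜ).HasFractionalFactor a b

/-- `G` is fractional ID-`k`-factor-critical: the case `a = b = k`. -/
def IsFractionalIDKFactorCritical {V : Type*} [Fintype V] (G : SimpleGraph V) (k : ℕ) : Prop :=
  G.IsFractionalIDFactorCritical k k

end SimpleGraph

/-!
A fractional `k`-factor of a graph `H` exists as soon as
`k |T| ≤ k |S| + ∑ x ∈ T, |N(x) \ S|` for all disjoint vertex sets `S` and `T`
(`SimpleGraph.hasFractionalFactor_of_disjoint`). To see this, pass to the bipartite double cover of
`H`, whose edges are the darts of `H`: a set of darts with `k` darts out of and `k` darts into every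
vertex gives a fractional `k`-factor, with the weight of an edge being half the number of its
selected darts. Such a set comes from Hall's theorem (`SimpleGraph.exists_regular_darts`): every
dart `(u, v)` has to occupy either one of `k` places at `v`, in which case it is selected, or one of
`d(u) - k` places at `u`. An injective assignment selects at most `k` darts into every vertex and at
least `k` darts out of every vertex, so both bounds are attained.

For an independent set `I` of `G`, the neighbourhoods of two distinct vertices of `I` cover at
least `2n/3` vertices, all outside `I`, so `|I| ≤ n/3`. The inequality for `G - I` is then a count
(`SimpleGraph.mul_card_le_of_degree_of_union`). One may assume `|N(x) \ S| < k` on `T`. Let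
`x` minimize `a = |N(x) \ S|` on `T`. If `T` lies in the closed neighbourhood of `x`, then
`|T| ≤ a + 1 ≤ k`, while the minimum degree gives `|S| ≥ k - a`. Otherwise let `y` minimize
`b = |N(y) \ S|` on the rest of `T`; the bound on the union of the neighbourhoods of `x` and `y`
gives `|S| + |I| ≥ 2n/3 - a - b`, and this is incompatible with `|T| ≤ n - |I| - |S|` and a
violated inequality.
-/

namespace SimpleGraph

/-! ### From a counting condition to a fractional factor -/

/-- A `k`-regular spanning subgraph of the bipartite double cover of `H`, as a set of ordered pairs
of adjacent vertices. -/
theorem exists_regular_darts {W : Type*} [Fintype W] [DecidableEq W] (H : SimpleGraph W)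
    [DecidableRel H.Adj] (k : ℕ)
    (hST : ∀ S T : Finset W, k * T.card ≤ k * S.card + ∑ x ∈ T, (H.neighborFinset x \ S).card) :
    ∃ D : Finset (W × W), (∀ p ∈ D, H.Adj p.1 p.2) ∧
      (∀ u, (D.filter (fun p => p.1 = u)).card = k) ∧
      (∀ v, (D.filter (fun p => p.2 = v)).card = k) := by
  have hdeg : ∀ u, k ≤ H.degree u := by
    intro u
    simpa using hST ∅ {u}
  let E := {p : W × W // H.Adj p.1 p.2}
  let places : E → Finset ((W × Fin k) ⊕ (Σ u : W, Fin (H.degree u - k))) := fun e =>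
    (({e.1.2} : Finset W) ×ˢ (Finset.univ : Finset (Fin k))).disjSum
      (({e.1.1} : Finset W).sigma (fun u => (Finset.univ : Finset (Fin (H.degree u - k)))))
  have hall : ∀ F : Finset E, F.card ≤ (F.biUnion places).card := by
    intro F
    let Z : Finset W := F.image (fun e => e.1.1)
    let Y : Finset W := F.image (fun e => e.1.2)
    have hB : F.biUnion places = (Y ×ˢ (Finset.univ : Finset (Fin k))).disjSum
        (Z.sigma (fun u => (Finset.univ : Finset (Fin (H.degree u - k))))) := by
      ext b
      rcases b with ⟨v, j⟩ | ⟨u, j⟩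
      · simp [places, Y, eq_comm]
      · simp [places, Z, eq_comm]
    have hcard : (F.biUnion places).card = Y.card * k + ∑ u ∈ Z, (H.degree u - k) := by
      rw [hB]
      simp
    have hF : F.card ≤ ∑ u ∈ Z, (H.neighborFinset u ∩ Y).card := by
      rw [← Finset.card_sigma]
      refine Finset.card_le_card_of_injOn (fun e => (⟨e.1.1, e.1.2⟩ : Σ _ : W, W)) ?_ ?_
      · intro e he
        have he : e ∈ F := he
        simp only [Finset.coe_sigma, Set.mem_sigma_iff, Finset.mem_coe, Finset.mem_inter,
          mem_neighborFinset]
        exact ⟨Finset.mem_image_of_mem _ he, e.2, Finset.mem_image_of_mem _ he⟩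
      · rintro ⟨⟨a, b⟩, _⟩ _ ⟨⟨c, d⟩, _⟩ _ h
        simp only [Sigma.mk.injEq, heq_eq_eq] at h
        obtain ⟨rfl, rfl⟩ := h
        rfl
    have h1 : ∑ u ∈ Z, (H.degree u - k) + k * Z.card = ∑ u ∈ Z, H.degree u := by
      rw [mul_comm, ← smul_eq_mul, ← Finset.sum_const, ← Finset.sum_add_distrib]
      exact Finset.sum_congr rfl fun u _ => Nat.sub_add_cancel (hdeg u)
    have h2 : ∑ u ∈ Z, (H.neighborFinset u ∩ Y).card + ∑ u ∈ Z, (H.neighborFinset u \ Y).card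
        = ∑ u ∈ Z, H.degree u := by
      rw [← Finset.sum_add_distrib]
      exact Finset.sum_congr rfl fun u _ => Finset.card_inter_add_card_sdiff _ _
    have h3 := hST Y Z
    rw [hcard, mul_comm]
    omega
  obtain ⟨f, hf, hfp⟩ := (Finset.all_card_le_biUnion_card_iff_exists_injective places).1 hall
  let D : Finset (W × W) := Finset.univ.filter (fun p => ∃ h : H.Adj p.1 p.2,
    ∃ q, f ⟨p, h⟩ = Sum.inl q)
  have hin : ∀ v, (D.filter (fun p => p.2 = v)).card ≤ k := by
    intro v
    have hsub : (D.filter (fun p => p.2 = v)).card ≤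
        (({v} : Finset W) ×ˢ (Finset.univ : Finset (Fin k))).card := by
      refine Finset.card_le_card_of_forall_subsingleton
        (fun p q => ∃ h : H.Adj p.1 p.2, f ⟨p, h⟩ = Sum.inl q) ?_ ?_
      · intro p hp
        simp only [D, Finset.mem_filter, Finset.mem_univ, true_and] at hp
        obtain ⟨⟨h, q, hq⟩, rfl⟩ := hp
        have := hfp ⟨p, h⟩
        rw [hq] at this
        exact ⟨q, by simpa [places] using this, h, hq⟩
      · rintro q - p ⟨-, h, hp⟩ p' ⟨-, h', hp'⟩
        exact congrArg Subtype.val (hf (hp.trans hp'.symm))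
    simpa using hsub
  have hout : ∀ u, k ≤ (D.filter (fun p => p.1 = u)).card := by
    intro u
    have hrest : ((H.neighborFinset u).filter (fun v => (u, v) ∉ D)).card ≤
        (({u} : Finset W).sigma
          (fun u => (Finset.univ : Finset (Fin (H.degree u - k))))).card := by
      refine Finset.card_le_card_of_forall_subsingleton
        (fun v q => ∃ h : H.Adj u v, f ⟨(u, v), h⟩ = Sum.inr q) ?_ ?_
      · intro v hv
        simp only [Finset.mem_filter, mem_neighborFinset, D, Finset.mem_univ, true_and] at hv
        obtain ⟨h, hv⟩ := hv
        rcases hq : f ⟨(u, v), h⟩ with q | q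
        · exact absurd ⟨h, q, hq⟩ hv
        · have := hfp ⟨(u, v), h⟩
          rw [hq] at this
          refine ⟨q, ?_, h, hq⟩
          simpa [places] using this
      · rintro q - v ⟨-, h, hp⟩ v' ⟨-, h', hp'⟩
        have := congrArg Subtype.val (hf (hp.trans hp'.symm))
        exact (Prod.mk.inj this).2
    have hsel : ((H.neighborFinset u).filter (fun v => (u, v) ∈ D)).card ≤
        (D.filter (fun p => p.1 = u)).card := by
      refine Finset.card_le_card_of_injOn (fun v => (u, v)) ?_ ?_
      · intro v hv
        have hv := (Finset.mem_filter.1 hv).2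
        exact Finset.mem_filter.2 ⟨hv, rfl⟩
      · intro v _ v' _ h
        exact (Prod.mk.inj h).2
    have hsplit := Finset.card_filter_add_card_filter_not (s := H.neighborFinset u)
      (fun v => (u, v) ∈ D)
    rw [card_neighborFinset_eq_degree] at hsplit
    have := hdeg u
    simp only [Finset.card_sigma, Finset.sum_singleton, Finset.card_univ, Fintype.card_fin]
      at hrest
    omega
  -- Both families of bounds are attained because they sum to the same total `|D|`.
  have hsum1 : ∑ u, (D.filter (fun p => p.1 = u)).card = D.card :=
    (Finset.card_eq_sum_card_fiberwise fun _ _ => Finset.mem_coe.2 (Finset.mem_univ _)).symm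
  have hsum2 : ∑ v, (D.filter (fun p => p.2 = v)).card = D.card :=
    (Finset.card_eq_sum_card_fiberwise fun _ _ => Finset.mem_coe.2 (Finset.mem_univ _)).symm
  have hle1 : ∑ _u : W, k ≤ ∑ u, (D.filter (fun p => p.1 = u)).card :=
    Finset.sum_le_sum fun u _ => hout u
  have hle2 : ∑ v, (D.filter (fun p => p.2 = v)).card ≤ ∑ _v : W, k :=
    Finset.sum_le_sum fun v _ => hin v
  refine ⟨D, fun p hp => (Finset.mem_filter.1 hp).2.1, fun u => ?_, fun v => ?_⟩
  · exact ((Finset.sum_eq_sum_iff_of_le fun u _ => hout u).1 (by omega) u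
      (Finset.mem_univ u)).symm
  · exact (Finset.sum_eq_sum_iff_of_le fun v _ => hin v).1 (by omega) v (Finset.mem_univ v)

theorem sum_incidenceFinset_eq {W : Type*} [DecidableEq W] (H : SimpleGraph W) (x : W)
    [Fintype (H.neighborSet x)] (h : Sym2 W → ℝ) :
    ∑ e ∈ H.incidenceFinset x, h e = ∑ y ∈ H.neighborFinset x, h s(x, y) := by
  symm
  refine Finset.sum_bij (fun y _ => s(x, y)) ?_ ?_ ?_ ?_
  · intro y hy
    simpa [mem_incidenceFinset, mk'_mem_incidenceSet_iff] using hy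
  · intro y _ y' _ h
    exact Sym2.congr_right.1 h
  · intro e he
    rw [mem_incidenceFinset] at he
    obtain ⟨he, hx⟩ := he
    obtain ⟨y, rfl⟩ := Sym2.mem_iff_exists.1 hx
    exact ⟨y, by simpa using he, rfl⟩
  · intro y _
    rfl

theorem hasFractionalFactor_of_regular_darts {W : Type*} [Fintype W] [DecidableEq W]
    (H : SimpleGraph W) (k : ℕ) (D : Finset (W × W)) (hD : ∀ p ∈ D, H.Adj p.1 p.2)
    (hout : ∀ u, (D.filter (fun p => p.1 = u)).card = k)
    (hin : ∀ v, (D.filter (fun p => p.2 = v)).card = k) :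
    H.HasFractionalFactor k k := by
  let h : Sym2 W → ℝ := Sym2.lift ⟨fun u v =>
    ((if (u, v) ∈ D then 1 else 0) + (if (v, u) ∈ D then 1 else 0)) / 2,
    fun u v => by simp only [add_comm]⟩
  refine ⟨h, ?_, ?_⟩
  · intro e _
    induction e with
    | _ u v =>
      simp only [h, Sym2.lift_mk]
      split_ifs <;> norm_num
  · intro x
    suffices hsum : ∀ (i : Fintype (H.neighborSet x)) (j : DecidableEq W),
        ∑ e ∈ @incidenceFinset W H x i j, h e = k from ⟨(hsum _ _).ge, (hsum _ _).le⟩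
    intro i j
    rw [sum_incidenceFinset_eq]
    clear j
    have h1 : ((D.filter (fun p => p.1 = x)).card : ℝ) =
        ∑ y ∈ H.neighborFinset x, if (x, y) ∈ D then (1 : ℝ) else 0 := by
      rw [Finset.sum_boole]
      congr 1
      refine Finset.card_bij' (fun p _ => p.2) (fun y _ => (x, y)) ?_ ?_ ?_ ?_
      · rintro ⟨u, v⟩ hp
        simp only [Finset.mem_filter] at hp
        obtain ⟨hp, rfl⟩ := hp
        simpa using ⟨hD _ hp, hp⟩
      · intro y hy
        simpa using (Finset.mem_filter.1 hy).2
      · rintro ⟨u, v⟩ hp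
        simp only [Finset.mem_filter] at hp
        rw [hp.2]
      · intro y _
        rfl
    have h2 : ((D.filter (fun p => p.2 = x)).card : ℝ) =
        ∑ y ∈ H.neighborFinset x, if (y, x) ∈ D then (1 : ℝ) else 0 := by
      rw [Finset.sum_boole]
      congr 1
      refine Finset.card_bij' (fun p _ => p.1) (fun y _ => (y, x)) ?_ ?_ ?_ ?_
      · rintro ⟨u, v⟩ hp
        simp only [Finset.mem_filter] at hp
        obtain ⟨hp, rfl⟩ := hp
        simpa using ⟨(hD _ hp).symm, hp⟩
      · intro y hy
        simpa using (Finset.mem_filter.1 hy).2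
      · rintro ⟨u, v⟩ hp
        simp only [Finset.mem_filter] at hp
        rw [hp.2]
      · intro y _
        rfl
    simp only [h, Sym2.lift_mk]
    rw [← Finset.sum_div, Finset.sum_add_distrib, ← h1, ← h2, hout, hin]
    ring

/-- The condition for disjoint `S` and `T` implies the one for arbitrary `S` and `T`: deleting
`S ∩ T` from both sets does not increase `k |S| + ∑ x ∈ T, |N(x) \ S| - k |T|`, since the edges
between `S ∩ T` and `T \ S`, newly counted at their ends in `T \ S`, were counted at their ends in
`S ∩ T` before. -/
theorem mul_card_le_of_disjoint {W : Type*} [Fintype W] [DecidableEq W] (H : SimpleGraph W)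
    [DecidableRel H.Adj] (k : ℕ)
    (hST : ∀ S T : Finset W, Disjoint S T →
      k * T.card ≤ k * S.card + ∑ x ∈ T, (H.neighborFinset x \ S).card) (S T : Finset W) :
    k * T.card ≤ k * S.card + ∑ x ∈ T, (H.neighborFinset x \ S).card := by
  have h0 := hST (S \ T) (T \ S) disjoint_sdiff_sdiff
  have hT := Finset.card_sdiff_add_card_inter T S
  have hS := Finset.card_sdiff_add_card_inter S T
  rw [Finset.inter_comm S T] at hS
  have hsplit : ∑ x ∈ T, (H.neighborFinset x \ S).card =
      ∑ x ∈ T ∩ S, (H.neighborFinset x \ S).card +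
        ∑ x ∈ T \ S, (H.neighborFinset x \ S).card :=
    (Finset.sum_inter_add_sum_sdiff T S _).symm
  have hout : ∑ x ∈ T \ S, (H.neighborFinset x \ (S \ T)).card ≤
      ∑ x ∈ T \ S, (H.neighborFinset x \ S).card +
        ∑ x ∈ T \ S, (H.neighborFinset x ∩ (T ∩ S)).card := by
    rw [← Finset.sum_add_distrib]
    refine Finset.sum_le_sum fun x _ => ?_
    refine (Finset.card_le_card ?_).trans (Finset.card_union_le _ _)
    intro y hy
    simp only [Finset.mem_sdiff, Finset.mem_union, Finset.mem_inter] at hy ⊢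
    tauto
  have hswap : ∑ x ∈ T \ S, (H.neighborFinset x ∩ (T ∩ S)).card =
      ∑ y ∈ T ∩ S, (H.neighborFinset y ∩ (T \ S)).card := by
    have := Finset.sum_card_bipartiteAbove_eq_sum_card_bipartiteBelow (s := T \ S) (t := T ∩ S)
      H.Adj
    convert this using 3 with x _ y _
    · ext z
      simp [Finset.mem_bipartiteAbove, and_comm]
    · ext z
      simp [Finset.mem_bipartiteBelow, and_comm, H.adj_comm]
  have hin : ∑ y ∈ T ∩ S, (H.neighborFinset y ∩ (T \ S)).card ≤
      ∑ y ∈ T ∩ S, (H.neighborFinset y \ S).card := by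
    refine Finset.sum_le_sum fun y _ => Finset.card_le_card fun z hz => ?_
    simp only [Finset.mem_sdiff, Finset.mem_inter] at hz ⊢
    tauto
  rw [← hT, ← hS, mul_add, mul_add]
  omega

/-- The sufficiency half of the fractional `k`-factor theorem. -/
theorem hasFractionalFactor_of_disjoint {W : Type*} [Fintype W] [DecidableEq W]
    (H : SimpleGraph W) [DecidableRel H.Adj] (k : ℕ)
    (hST : ∀ S T : Finset W, Disjoint S T →
      k * T.card ≤ k * S.card + ∑ x ∈ T, (H.neighborFinset x \ S).card) :
    H.HasFractionalFactor k k := by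
  obtain ⟨D, hD, hout, hin⟩ := H.exists_regular_darts k (H.mul_card_le_of_disjoint k hST)
  exact H.hasFractionalFactor_of_regular_darts k D hD hout hin

/-! ### The counting condition -/

/-- The inequality that refutes a violating pair `S`, `T` whose set `T` is not contained in the
closed neighbourhood of a vertex of least degree. Here `a ≤ b` are the degrees outside `S` of two
nonadjacent vertices of `T`. -/
theorem le_of_union_bound {k n i s t a b : ℤ} (hn : 12 * k ≤ n + 8) (hi : 3 * i ≤ n)
    (ha : 0 ≤ a) (hab : a ≤ b) (hbk : b < k) (hst : s + t + i ≤ n)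
    (hU : 2 * n ≤ 3 * (a + b + s + i)) :
    (k - b) * t ≤ k * s + (a - b) * (a + 1) := by
  have e1 : (k - b) * t ≤ (k - b) * (n - s - i) :=
    mul_le_mul_of_nonneg_left (by linarith) (by linarith)
  have e2 : 0 ≤ (2 * k - b) * (3 * (a + b + s + i) - 2 * n) :=
    mul_nonneg (by linarith) (by linarith)
  have e3 : 0 ≤ k * (n - 3 * i) := mul_nonneg (by linarith) (by linarith)
  have e4 : 0 ≤ b * (n + 8 - 12 * k) := mul_nonneg (by linarith) (by linarith)
  have e5 : 0 ≤ (b - a) * (k - b - 1) := mul_nonneg (by linarith) (by linarith)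
  -- With `q` the right side below, `e1`, ..., `e5` show that right side minus left side of the goal
  -- is at least `q / 3`. By integrality `-3 < q` suffices; `q = -2` does occur, for `a = b = 1`.
  have e6 : -3 < 6 * (b + 1) * (b - a) + 3 * a ^ 2 + 3 * b ^ 2 + 3 * a - 11 * b := by
    rcases hab.eq_or_lt with rfl | hlt
    · rcases le_or_gt a 1 with h | h
      · interval_cases a <;> norm_num
      · nlinarith
    · nlinarith [mul_nonneg (by linarith : 0 ≤ b + 1) (by linarith : 0 ≤ b - a - 1),
        sq_nonneg (b - 1)]
  nlinarith

/-- The counting condition for `H = G - I` with `|I| = i`, where the bounds for `G` on degrees and on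
unions of neighbourhoods are weakened by the `i` deleted vertices. -/
theorem mul_card_le_of_degree_of_union {W : Type*} [Fintype W] [DecidableEq W]
    (H : SimpleGraph W) [DecidableRel H.Adj] {k n i : ℕ} (hn : 12 * k ≤ n + 8) (hi : 3 * i ≤ n)
    (hcard : Fintype.card W + i = n) (hdeg : ∀ x, n + 3 * k ≤ 3 * (H.degree x + i))
    (hunion : ∀ x y, x ≠ y → ¬ H.Adj x y →
      2 * n ≤ 3 * ((H.neighborFinset x ∪ H.neighborFinset y).card + i))
    (S T : Finset W) (hST : Disjoint S T) :
    k * T.card ≤ k * S.card + ∑ x ∈ T, (H.neighborFinset x \ S).card := by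
  set d : W → ℕ := fun x => (H.neighborFinset x \ S).card with hd
  -- Vertices with `k ≤ d x` only help, so that `T` may be replaced by `R`.
  let R := T.filter (fun x => d x < k)
  suffices hR : k * R.card ≤ k * S.card + ∑ x ∈ R, d x by
    have h1 := Finset.card_filter_add_card_filter_not (s := T) (fun x => d x < k)
    have h2 := Finset.sum_filter_add_sum_filter_not T (fun x => d x < k) d
    have h3 : (T.filter (fun x => ¬ d x < k)).card * k ≤
        ∑ x ∈ T.filter (fun x => ¬ d x < k), d x := by
      rw [← smul_eq_mul]
      exact Finset.card_nsmul_le_sum _ _ _ fun x hx => not_lt.1 (Finset.mem_filter.1 hx).2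
    rw [← h1, mul_add, ← h2]
    rw [mul_comm] at h3
    change k * R.card + _ ≤ _ + (∑ x ∈ R, d x + _)
    omega
  rcases R.eq_empty_or_nonempty with hRe | hRne
  · simp [hRe]
  obtain ⟨x, hxR, hx⟩ := R.exists_min_image d hRne
  have hxk : d x < k := (Finset.mem_filter.1 hxR).2
  have hRS : ∀ z ∈ R, z ∉ S := fun z hz hzS =>
    Finset.disjoint_left.1 hST hzS (Finset.mem_filter.1 hz).1
  let C := R.filter (fun z => z = x ∨ H.Adj x z)
  have hC : C.card ≤ d x + 1 := by
    refine (Finset.card_le_card ?_).trans (Finset.card_insert_le x (H.neighborFinset x \ S))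
    intro z hz
    obtain ⟨hzR, hz⟩ := Finset.mem_filter.1 hz
    have := hRS z hzR
    simp only [Finset.mem_insert, Finset.mem_sdiff, mem_neighborFinset]
    tauto
  have hdx : H.degree x ≤ d x + S.card := by
    rw [← card_neighborFinset_eq_degree]
    exact Finset.card_le_card_sdiff_add_card
  rcases (R \ C).eq_empty_or_nonempty with hRC | hRC
  · have hle : R.card ≤ C.card := Finset.card_le_card (Finset.sdiff_eq_empty_iff_subset.1 hRC)
    have hs : k ≤ d x + S.card := by
      have := hdeg x
      omega
    have hsum : R.card * d x ≤ ∑ z ∈ R, d z := by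
      rw [← smul_eq_mul]
      exact Finset.card_nsmul_le_sum _ _ _ hx
    have hRk : R.card ≤ k := by omega
    refine le_trans ?_ (Nat.add_le_add_left hsum _)
    zify at hs hRk hxk ⊢
    nlinarith [mul_nonneg (sub_nonneg.2 hxk.le) (sub_nonneg.2 hRk)]
  · obtain ⟨y, hyRC, hy⟩ := (R \ C).exists_min_image d hRC
    obtain ⟨hyR, hyC⟩ := Finset.mem_sdiff.1 hyRC
    have hyC : y ≠ x ∧ ¬ H.Adj x y := by
      simpa [C, hyR] using hyC
    have hyk : d y < k := (Finset.mem_filter.1 hyR).2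
    have hU : 2 * n ≤ 3 * (d x + d y + S.card + i) := by
      refine (hunion x y hyC.1.symm hyC.2).trans ?_
      have h1 : (H.neighborFinset x ∪ H.neighborFinset y).card ≤ d x + d y + S.card := by
        refine (Finset.card_le_card (t := (H.neighborFinset x \ S) ∪ (H.neighborFinset y \ S) ∪ S)
          ?_).trans ((Finset.card_union_le _ _).trans
            (Nat.add_le_add_right (Finset.card_union_le _ _) _))
        intro z hz
        simp only [Finset.mem_sdiff, Finset.mem_union] at hz ⊢
        tauto
      omega
    have hst : S.card + R.card + i ≤ n := by
      have hdisj : Disjoint S R := Finset.disjoint_right.2 hRS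
      have := Finset.card_le_univ (S ∪ R)
      rw [Finset.card_union_of_disjoint hdisj] at this
      omega
    have hsumC : C.card * d x ≤ ∑ z ∈ C, d z := by
      rw [← smul_eq_mul]
      exact Finset.card_nsmul_le_sum _ _ _ fun z hz => hx z (Finset.mem_filter.1 hz).1
    have hsumRC : (R \ C).card * d y ≤ ∑ z ∈ R \ C, d z := by
      rw [← smul_eq_mul]
      exact Finset.card_nsmul_le_sum _ _ _ hy
    have hCR : C ⊆ R := Finset.filter_subset _ _
    rw [← Finset.sum_sdiff hCR]
    have hcards := Finset.card_sdiff_add_card_eq_card hCR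
    have hxy := hx y hyR
    have key := le_of_union_bound (k := k) (n := n) (i := i) (s := S.card) (t := R.card)
      (a := d x) (b := d y) (by exact_mod_cast hn) (by exact_mod_cast hi) (by positivity)
      (by exact_mod_cast hxy) (by exact_mod_cast hyk) (by exact_mod_cast hst)
      (by exact_mod_cast hU)
    zify at hsumC hsumRC hcards hxy hC ⊢
    have h5 := mul_nonneg (sub_nonneg.2 hxy) (sub_nonneg.2 hC)
    have h6 : ((R \ C).card : ℤ) * d y = (R.card - C.card) * d y := by
      rw [← hcards]
      ring
    nlinarith

/-! ### Deleting an independent set -/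

/-- Two nonadjacent vertices of an independent set have all their neighbours outside of it. -/
theorem three_mul_card_indepSet_le {V : Type*} [Fintype V] [DecidableEq V] (G : SimpleGraph V)
    [DecidableRel G.Adj] (h3 : 3 ≤ Fintype.card V)
    (hnbr : ∀ x y : V, x ≠ y → ¬ G.Adj x y →
      2 * Fintype.card V ≤ 3 * (G.neighborFinset x ∪ G.neighborFinset y).card)
    (J : Finset V) (hJ : G.IsIndepSet J) : 3 * J.card ≤ Fintype.card V := by
  rcases le_or_gt J.card 1 with h | h
  · omega
  obtain ⟨x, hx, y, hy, hxy⟩ := Finset.one_lt_card.1 h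
  have h1 := hnbr x y hxy (hJ hx hy hxy)
  have hdisj : Disjoint J (G.neighborFinset x ∪ G.neighborFinset y) := by
    refine Finset.disjoint_left.2 fun z hz hzN => ?_
    rw [Finset.mem_union, mem_neighborFinset, mem_neighborFinset] at hzN
    rcases hzN with hz' | hz'
    · exact hJ hx hz hz'.ne hz'
    · exact hJ hy hz hz'.ne hz'
  have h2 := Finset.card_le_univ (J ∪ (G.neighborFinset x ∪ G.neighborFinset y))
  rw [Finset.card_union_of_disjoint hdisj] at h2
  omega

theorem neighborFinset_subset_of_induce {V : Type*} [Fintype V] [DecidableEq V]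
    (G : SimpleGraph V) [DecidableRel G.Adj] (J : Finset V) (I : Set V) (hJ : ∀ z, z ∈ J ↔ z ∈ I)
    [Fintype (Iᶜ : Set V)] [DecidableRel (G.induce Iᶜ).Adj] (x : (Iᶜ : Set V)) :
    G.neighborFinset x ⊆
      ((G.induce Iᶜ).neighborFinset x).map (Function.Embedding.subtype _) ∪ J := by
  intro z hz
  by_cases hzI : z ∈ I
  · simp [hJ, hzI]
  · rw [Finset.mem_union]
    refine Or.inl (Finset.mem_map.2 ⟨⟨z, hzI⟩, ?_, rfl⟩)
    simpa using hz

end SimpleGraph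

theorem corollary1 {V : Type*} [Fintype V] [DecidableEq V] (G : SimpleGraph V)
    [DecidableRel G.Adj] (k n : ℕ) (hk : 1 ≤ k) (hcard : Fintype.card V = n)
    (hn : 12 * (k : ℝ) - 8 ≤ (n : ℝ))
    (hdeg : (n : ℝ) / 3 + (k : ℝ) ≤ (G.minDegree : ℝ))
    (hnbr : ∀ x y : V, x ≠ y → ¬ G.Adj x y →
      2 * (n : ℝ) / 3 ≤ ((G.neighborFinset x ∪ G.neighborFinset y).card : ℝ)) :
    G.IsFractionalIDKFactorCritical k := by
  classical
  have hn' : 12 * k ≤ n + 8 := by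
    have : 12 * (k : ℝ) ≤ n + 8 := by linarith
    exact_mod_cast this
  have hdeg' : ∀ x, n + 3 * k ≤ 3 * G.degree x := by
    intro x
    have h1 : (n : ℝ) + 3 * k ≤ 3 * G.minDegree := by linarith
    have h2 : n + 3 * k ≤ 3 * G.minDegree := by exact_mod_cast h1
    have := G.minDegree_le_degree x
    omega
  have hnbr' : ∀ x y : V, x ≠ y → ¬ G.Adj x y →
      2 * n ≤ 3 * (G.neighborFinset x ∪ G.neighborFinset y).card := by
    intro x y hxy hadj
    have h1 := hnbr x y hxy hadj
    have h2 : 2 * (n : ℝ) ≤ 3 * (G.neighborFinset x ∪ G.neighborFinset y).card := by linarith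
    exact_mod_cast h2
  intro I hI
  let J : Finset V := I.toFinset
  have hJ : ∀ z, z ∈ J ↔ z ∈ I := fun z => Set.mem_toFinset
  have hJ3 : 3 * J.card ≤ n := by
    subst hcard
    refine G.three_mul_card_indepSet_le (by omega) hnbr' J ?_
    simpa [J] using hI
  refine SimpleGraph.hasFractionalFactor_of_disjoint _ k
    (SimpleGraph.mul_card_le_of_degree_of_union _ hn' hJ3 ?_ ?_ ?_)
  · have h1 := Fintype.card_compl_set I
    have h2 : J.card = Fintype.card I := Set.toFinset_card I
    have h3 := Finset.card_le_univ J
    rw [← hcard]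
    omega
  · intro x
    refine (hdeg' x).trans (Nat.mul_le_mul_left 3 ?_)
    rw [← SimpleGraph.card_neighborFinset_eq_degree, ← SimpleGraph.card_neighborFinset_eq_degree]
    refine (Finset.card_le_card (G.neighborFinset_subset_of_induce J I hJ x)).trans ?_
    refine (Finset.card_union_le _ _).trans ?_
    rw [Finset.card_map]
  · intro x y hxy hadj
    refine (hnbr' x y (fun h => hxy (Subtype.ext h)) (by simpa using hadj)).trans
      (Nat.mul_le_mul_left 3 ?_)
    refine (Finset.card_le_card (Finset.union_subset_union
      (G.neighborFinset_subset_of_induce J I hJ x)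
      (G.neighborFinset_subset_of_induce J I hJ y))).trans ?_
    rw [← Finset.union_union_distrib_right, ← Finset.map_union]
    refine (Finset.card_union_le _ _).trans ?_
    rw [Finset.card_map]
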